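/- Let $M$ be a $C^\infty$ manifold without boundary. A para-Hermitian structure on $M$ is a pair $(\gamma,F)$, where $\gamma$ is a smooth, symmetric, non-degenerate bilinear form on $TM$ and $F$ is a smooth field of endomorphisms of $TM$, such that $F^2=\mathrm{Id}$, the $\pm1$-eigenbundles $L,\bar L$ of $F$ have equal rank and are integrable (involutive), and $\gamma(FX,Y)=-\gamma(X,FY)$. Its fundamental form is $\omega(X,Y)=\gamma(X,FY)$; the structure is para-Kähler if $d\omega=0$. Write $X=X_L+X_{\bar L}$ for the decomposition along $TM=L\oplus\bar L$. Put $\flat_\omega X=i(X)\omega$, $\sharp_\omega=\flat_\omega^{-1}$, and let $pr_{\mathrm{ann}\,\bar L}$, $pr_{\mathrm{ann}\,L}$ be the projections of $T^*M=\mathrm{ann}\,L\oplus\mathrm{ann}\,\bar L$. For smooth vector fields $X,Y$ on $M$ define two brackets. The metric bracket is $[X,Y]_\gamma=[X,Y]-X\wedge_{\nabla}Y$, where $\nabla$ is the Levi-Civita connection of $\gamma$ and $\gamma(Z,X\wedge_{\nabla}Y)=\tfrac12\big(\gamma(X,\nabla_ZY)-\gamma(Y,\nabla_ZX)\big)$ for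 all $Z$. The bracket $[X,Y]_\omega=[X,Y]_{(L,\bar L)}+[X,Y]_{(\bar L,L)}$ is the sum of the Courant brackets of the two foliations, where $$[X,Y]_{(L,\bar L)}=[X_L,Y_L]+\sharp_\omega\, pr_{\mathrm{ann}\,\bar L}\Big[\mathfrak L_{X_L}i(Y_{\bar L})\omega-\mathfrak L_{Y_L}i(X_{\bar L})\omega+\tfrac12 d(\omega(X,Y))\Big]$$ is the Courant bracket of $L\oplus T^*M/\mathrm{ann}\,L$, transferred to $TM$ by $X\mapsto(X_L,\flat_\omega X_{\bar L})$, and $[X,Y]_{(\bar L,L)}$ is obtained by exchanging $L$ and $\bar L$ and replacing $\omega$ by $-\omega$. **Proposition.** On any para-Hermitian manifold, for all smooth vector fields $X,Y$, $$[X,Y]_\gamma=[X,Y]_\omega+\tfrac12\,\sharp_\omega\big(i(FY)\,i(FX)\,d\omega\big).$$ Hence on a para-Kähler manifold the brackets $[\,,\,]_\gamma$ and $[\,,\,]_\omega$ coincide. (The bracket $[\,,\,]_\gamma$ is called the para-Hermitian C-bracket.) -/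

import Mathlib

open Bundle FiberBundle VectorField
open scoped Manifold ContDiff Topology

set_option linter.unusedSectionVars false

noncomputable section

namespace ParaHermitian

section Definitions

variable {E : Type*} [NormedAddCommGroup E] [NormedSpace ℝ E] [FiniteDimensional ℝ E]
  {M : Type*} [TopologicalSpace M] [ChartedSpace E M]

/-! ### Tensor fields on a manifold `M` without boundary, modelled on `E` -/

variable (E M) in
/-- Vector fields (smoothness is stated separately). -/
abbrev VField : Type _ := (x : M) → TangentSpace 𝓘(ℝ, E) x

variable (E M) in
/-- Fields of linear forms. -/
abbrev OneForm : Type _ := (x : M) → TangentSpace 𝓘(ℝ, E) x →L[ℝ] ℝ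

variable (E M) in
/-- Fields of bilinear forms. -/
abbrev BilinField : Type _ :=
  (x : M) → TangentSpace 𝓘(ℝ, E) x →L[ℝ] TangentSpace 𝓘(ℝ, E) x →L[ℝ] ℝ

variable (E M) in
/-- Fields of endomorphisms of the tangent bundle. -/
abbrev EndField : Type _ :=
  (x : M) → TangentSpace 𝓘(ℝ, E) x →L[ℝ] TangentSpace 𝓘(ℝ, E) x

variable [IsManifold 𝓘(ℝ, E) ∞ M]

/-- `X` is a vector field of class `C^∞`. -/
def VField.Smooth (X : VField E M) : Prop :=
  ContMDiff 𝓘(ℝ, E) (𝓘(ℝ, E).prod 𝓘(ℝ, E)) ∞ (fun x ↦ TotalSpace.mk' E x (X x))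

/-- `X` is of class `C^∞` near `x`. -/
def VField.SmoothAt (X : VField E M) (x : M) : Prop :=
  ContMDiffAt 𝓘(ℝ, E) (𝓘(ℝ, E).prod 𝓘(ℝ, E)) ∞ (fun x ↦ TotalSpace.mk' E x (X x)) x

def BilinField.Smooth (B : BilinField E M) : Prop :=
  ContMDiff 𝓘(ℝ, E) (𝓘(ℝ, E).prod 𝓘(ℝ, E →L[ℝ] E →L[ℝ] ℝ)) ∞
    (fun x ↦ TotalSpace.mk' (E →L[ℝ] E →L[ℝ] ℝ) x (B x))

def EndField.Smooth (F : EndField E M) : Prop :=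
  ContMDiff 𝓘(ℝ, E) (𝓘(ℝ, E).prod 𝓘(ℝ, E →L[ℝ] E)) ∞
    (fun x ↦ TotalSpace.mk' (E →L[ℝ] E) x (F x))

/-- `α` is differentiable at `x`, as a section of the cotangent bundle. -/
def OneForm.DiffAt (α : OneForm E M) (x : M) : Prop :=
  MDifferentiableAt 𝓘(ℝ, E) (𝓘(ℝ, E).prod 𝓘(ℝ, E →L[ℝ] ℝ))
    (fun x ↦ TotalSpace.mk' (E →L[ℝ] ℝ) x (α x)) x

/-- `♭_B X = i(X) B = B(X, ·)`. -/
def flat (B : BilinField E M) (X : VField E M) : OneForm E M := fun x ↦ B x (X x)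

/-- `♯_B`, the inverse of `♭_B`, at a point (used for non degenerate `B` only). -/
def sharp (B : BilinField E M) (x : M) (α : TangentSpace 𝓘(ℝ, E) x →L[ℝ] ℝ) :
    TangentSpace 𝓘(ℝ, E) x :=
  (B x).inverse α

/-! ### Pseudo-Riemannian metrics and the Levi-Civita connection -/

variable (E M) in
/-- A smooth, symmetric, non degenerate field of bilinear forms, of any signature. -/
structure PseudoMetric where
  val : BilinField E M
  smooth : val.Smooth
  symm : ∀ x u v, val x u v = val x v u
  nondegenerate : ∀ x u, (∀ v, val x u v = 0) → u = 0

lemma BilinField.Smooth.mdifferentiableAt {B : BilinField E M} (hB : B.Smooth) {x : M}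
    {X Y : VField E M} (hX : MDiffAt (T% X) x) (hY : MDiffAt (T% Y) x) :
    MDiffAt (fun y ↦ B y (X y) (Y y)) x := by
  have h := (hB x).mdifferentiableAt (by simp)
  have : MDifferentiableAt 𝓘(ℝ, E) (𝓘(ℝ, E).prod 𝓘(ℝ, ℝ))
      (fun y ↦ TotalSpace.mk' ℝ (E := Bundle.Trivial M ℝ) y (B y (X y) (Y y))) x :=
    MDifferentiableAt.clm_bundle_apply₂ (F₁ := E) (F₂ := E) h hX hY
  simp only [mdifferentiableAt_section] at this
  exact this

lemma OneForm.DiffAt.mdifferentiableAt {α : OneForm E M} {x : M} (hα : α.DiffAt x)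
    {X : VField E M} (hX : MDiffAt (T% X) x) : MDiffAt (fun y ↦ α y (X y)) x := by
  have : MDifferentiableAt 𝓘(ℝ, E) (𝓘(ℝ, E).prod 𝓘(ℝ, ℝ))
      (fun y ↦ TotalSpace.mk' ℝ (E := Bundle.Trivial M ℝ) y (α y (X y))) x :=
    MDifferentiableAt.clm_bundle_apply (F₁ := E) hα hX
  simp only [mdifferentiableAt_section] at this
  exact this

/-- Half of the right hand side of the Koszul formula for `2 γ(∇_X Y, Z)`. -/
def koszul (g : BilinField E M) (X Y Z : VField E M) (x : M) : ℝ :=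
  (1 / 2) * (mvfderiv 𝓘(ℝ, E) (fun y ↦ g y (Y y) (Z y)) x (X x)
    + mvfderiv 𝓘(ℝ, E) (fun y ↦ g y (X y) (Z y)) x (Y x)
    - mvfderiv 𝓘(ℝ, E) (fun y ↦ g y (X y) (Y y)) x (Z x)
    + g x (mlieBracket 𝓘(ℝ, E) X Y x) (Z x)
    - g x (mlieBracket 𝓘(ℝ, E) X Z x) (Y x)
    - g x (mlieBracket 𝓘(ℝ, E) Y Z x) (X x))

section Koszul

variable (g : PseudoMetric E M) {X Y Z : VField E M} {x : M}

lemma koszul_tensorial_right (hX : MDiffAt (T% X) x) (hY : MDiffAt (T% Y) x) :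
    TensorialAt 𝓘(ℝ, E) E (fun Z : VField E M ↦ koszul g.val X Y Z x) x where
  smul {f Z} hf hZ := by
    have h1 := g.smooth.mdifferentiableAt hY hZ
    have h2 := g.smooth.mdifferentiableAt hX hZ
    simp only [koszul, Pi.smul_apply', map_smul, smul_eq_mul, mvfderiv_fun_mul hf h1,
      mvfderiv_fun_mul hf h2, mlieBracket_smul_right hf hZ, map_add, add_apply,
      smul_apply, g.symm x (Z x)]
    ring
  add {Z Z'} hZ hZ' := by
    simp only [koszul, Pi.add_apply, map_add,
      mvfderiv_fun_add (g.smooth.mdifferentiableAt hY hZ) (g.smooth.mdifferentiableAt hY hZ'),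
      mvfderiv_fun_add (g.smooth.mdifferentiableAt hX hZ) (g.smooth.mdifferentiableAt hX hZ'),
      mlieBracket_add_right hZ hZ', add_apply]
    ring

lemma koszul_tensorial_left (hY : MDiffAt (T% Y) x) (hZ : MDiffAt (T% Z) x) :
    TensorialAt 𝓘(ℝ, E) E (fun X : VField E M ↦ koszul g.val X Y Z x) x where
  smul {f X} hf hX := by
    have h1 := g.smooth.mdifferentiableAt hX hY
    have h2 := g.smooth.mdifferentiableAt hX hZ
    simp only [koszul, Pi.smul_apply', map_smul, smul_eq_mul, mvfderiv_fun_mul hf h1,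
      mvfderiv_fun_mul hf h2, mlieBracket_smul_left hf hX, map_add, add_apply,
      smul_apply, neg_smul, map_neg,
      neg_apply]
    ring
  add {X X'} hX hX' := by
    simp only [koszul, Pi.add_apply, map_add,
      mvfderiv_fun_add (g.smooth.mdifferentiableAt hX hY) (g.smooth.mdifferentiableAt hX' hY),
      mvfderiv_fun_add (g.smooth.mdifferentiableAt hX hZ) (g.smooth.mdifferentiableAt hX' hZ),
      mlieBracket_add_left hX hX', add_apply]
    ring

lemma koszul_add {Y' : VField E M} (hX : MDiffAt (T% X) x) (hY : MDiffAt (T% Y) x)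
    (hY' : MDiffAt (T% Y') x) (hZ : MDiffAt (T% Z) x) :
    koszul g.val X (Y + Y') Z x = koszul g.val X Y Z x + koszul g.val X Y' Z x := by
  simp only [koszul, Pi.add_apply, map_add,
    mvfderiv_fun_add (g.smooth.mdifferentiableAt hY hZ) (g.smooth.mdifferentiableAt hY' hZ),
    mvfderiv_fun_add (g.smooth.mdifferentiableAt hX hY) (g.smooth.mdifferentiableAt hX hY'),
    mlieBracket_add_left hY hY', mlieBracket_add_right hY hY', add_apply]
  ring

lemma koszul_leibniz {f : M → ℝ} (hX : MDiffAt (T% X) x) (hY : MDiffAt (T% Y) x)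
    (hf : MDiffAt f x) (hZ : MDiffAt (T% Z) x) :
    koszul g.val X (f • Y) Z x
      = f x * koszul g.val X Y Z x + mvfderiv 𝓘(ℝ, E) f x (X x) * g.val x (Y x) (Z x) := by
  have h1 := g.smooth.mdifferentiableAt hY hZ
  have h2 := g.smooth.mdifferentiableAt hX hY
  simp only [koszul, Pi.smul_apply', map_smul, smul_eq_mul, mvfderiv_fun_mul hf h1,
    mvfderiv_fun_mul hf h2, mlieBracket_smul_left hf hY, mlieBracket_smul_right hf hY, map_add,
    add_apply, smul_apply, g.symm x (Y x) (X x), neg_smul,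
    map_neg, neg_apply]
  ring

/-- The bilinear form `(u, z) ↦ γ(∇_u Y, z)` on `T_x M`. -/
def koszulForm (Y : VField E M) (x : M) (hY : MDiffAt (T% Y) x) :
    TangentSpace 𝓘(ℝ, E) x →L[ℝ] TangentSpace 𝓘(ℝ, E) x →L[ℝ] ℝ :=
  TensorialAt.mkHom₂ (fun X Z : VField E M ↦ koszul g.val X Y Z x) x
    (fun _ hZ ↦ koszul_tensorial_left g hY hZ) (fun _ hX ↦ koszul_tensorial_right g hX hY)

lemma koszulForm_apply (hX : MDiffAt (T% X) x) (hY : MDiffAt (T% Y) x) (hZ : MDiffAt (T% Z) x) :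
    koszulForm g Y x hY (X x) (Z x) = koszul g.val X Y Z x :=
  TensorialAt.mkHom₂_apply _ _ hX hZ

end Koszul

instance (x : M) : FiniteDimensional ℝ (TangentSpace 𝓘(ℝ, E) x) :=
  inferInstanceAs (FiniteDimensional ℝ E)

instance (x : M) : T2Space (TangentSpace 𝓘(ℝ, E) x) := inferInstanceAs (T2Space E)

lemma apply_inverse {V : Type*} [NormedAddCommGroup V] [NormedSpace ℝ V] [FiniteDimensional ℝ V]
    {B : V →L[ℝ] V →L[ℝ] ℝ} (hB : ∀ u, (∀ v, B u v = 0) → u = 0) (α : V →L[ℝ] ℝ) :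
    B (B.inverse α) = α := by
  have hinj : Function.Injective B := by
    rw [injective_iff_map_eq_zero]
    intro u hu
    exact hB u fun v ↦ by simp [hu]
  have hdim : Module.finrank ℝ V = Module.finrank ℝ (V →L[ℝ] ℝ) := by
    rw [← (LinearMap.toContinuousLinearMap (𝕜 := ℝ) (E := V) (F' := ℝ)).finrank_eq]
    exact (Subspace.dual_finrank_eq (K := ℝ) (V := V)).symm
  let e : V ≃L[ℝ] (V →L[ℝ] ℝ) :=
    (LinearEquiv.ofInjectiveOfFinrankEq B.toLinearMap hinj hdim).toContinuousLinearEquiv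
  have he : (e : V →L[ℝ] (V →L[ℝ] ℝ)) = B := by ext; rfl
  rw [← he, ContinuousLinearMap.inverse_equiv]
  exact e.apply_symm_apply α

/-- `♯_B` is the inverse of `♭_B` when `B` is non degenerate. -/
lemma apply_sharp {B : BilinField E M} {x : M} (hB : ∀ u, (∀ v, B x u v = 0) → u = 0)
    (α : TangentSpace 𝓘(ℝ, E) x →L[ℝ] ℝ) : B x (sharp B x α) = α :=
  apply_inverse (V := E) (B := B x) hB α

section LeviCivita

variable (g : PseudoMetric E M) {X Y Z : VField E M} {x : M}

open Classical in
/-- The operator `Y ↦ (x ↦ (u ↦ (∇_u Y)(x)))` given by the Koszul formula (with the value `0` where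
`Y` is not differentiable). -/
def leviCivitaFun (Y : VField E M) (x : M) :
    TangentSpace 𝓘(ℝ, E) x →L[ℝ] TangentSpace 𝓘(ℝ, E) x :=
  if hY : MDiffAt (T% Y) x then (g.val x).inverse.comp (koszulForm g Y x hY) else 0

lemma leviCivitaFun_apply (hX : MDiffAt (T% X) x) (hY : MDiffAt (T% Y) x)
    (hZ : MDiffAt (T% Z) x) :
    g.val x (leviCivitaFun g Y x (X x)) (Z x) = koszul g.val X Y Z x := by
  rw [leviCivitaFun, dif_pos hY, ← koszulForm_apply g hX hY hZ]
  exact congr($(apply_sharp (g.nondegenerate x) (koszulForm g Y x hY (X x))) (Z x))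

lemma PseudoMetric.ext_right {u v : TangentSpace 𝓘(ℝ, E) x}
    (h : ∀ w, g.val x u w = g.val x v w) : u = v :=
  sub_eq_zero.1 (g.nondegenerate x _ fun w ↦ by simp [h])

/-- The Levi-Civita connection of a pseudo-Riemannian metric. -/
def leviCivita : CovariantDerivative 𝓘(ℝ, E) E (TangentSpace 𝓘(ℝ, E) : M → Type _) where
  toFun := leviCivitaFun g
  isCovariantDerivativeOnUniv :=
    { add := by
        intro Y Y' x hY hY' _
        ext u
        refine g.ext_right fun z ↦ ?_
        have hu := mdifferentiableAt_extend 𝓘(ℝ, E) E u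
        have hz := mdifferentiableAt_extend 𝓘(ℝ, E) E z
        have h := leviCivitaFun_apply g hu (mdifferentiableAt_add_section hY hY') hz
        have h1 := leviCivitaFun_apply g hu hY hz
        have h2 := leviCivitaFun_apply g hu hY' hz
        have h3 := koszul_add g hu hY hY' hz
        simp only [extend_apply_self] at h h1 h2
        simp only [add_apply, map_add]
        rw [h1, h2, ← h3]
        exact h
      leibniz := by
        intro Y f x hY hf _
        ext u
        refine g.ext_right fun z ↦ ?_
        have hu := mdifferentiableAt_extend 𝓘(ℝ, E) E u
        have hz := mdifferentiableAt_extend 𝓘(ℝ, E) E z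
        have h := leviCivitaFun_apply g hu (hf.smul_section hY) hz
        have h1 := leviCivitaFun_apply g hu hY hz
        have h3 := koszul_leibniz g hu hY hf hz
        simp only [extend_apply_self] at h h1 h3
        simp only [add_apply, smul_apply, ContinuousLinearMap.smulRight_apply, map_add, map_smul,
          smul_eq_mul]
        rw [h1, ← h3]
        exact h }

/-- The Levi-Civita connection has no torsion. -/
lemma leviCivita_torsion : (leviCivita g).torsion = 0 := by
  rw [CovariantDerivative.torsion_eq_zero_iff]
  intro X Y x hX hY
  refine g.ext_right fun z ↦ ?_
  have hz := mdifferentiableAt_extend 𝓘(ℝ, E) E z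
  have h1 := leviCivitaFun_apply g hX hY hz
  have h2 := leviCivitaFun_apply g hY hX hz
  simp only [extend_apply_self] at h1 h2
  simp only [leviCivita, map_sub, sub_apply]
  rw [h1, h2]
  simp only [koszul, mlieBracket_swap_apply (V := Y) (W := X), map_neg, neg_apply,
    extend_apply_self]
  rw [show (fun y ↦ g.val y (Y y) (X y)) = fun y ↦ g.val y (X y) (Y y) from
    funext fun y ↦ g.symm y _ _]
  ring

/-- The Levi-Civita connection preserves the metric. -/
lemma leviCivita_metric (hX : MDiffAt (T% X) x) (hY : MDiffAt (T% Y) x) (hZ : MDiffAt (T% Z) x) :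
    mvfderiv 𝓘(ℝ, E) (fun y ↦ g.val y (Y y) (Z y)) x (X x)
      = g.val x (leviCivita g Y x (X x)) (Z x) + g.val x (Y x) (leviCivita g Z x (X x)) := by
  have h1 := leviCivitaFun_apply g hX hY hZ
  have h2 := leviCivitaFun_apply g hX hZ hY
  rw [g.symm x (Y x)]
  simp only [leviCivita]
  rw [h1, h2]
  simp only [koszul, mlieBracket_swap_apply (V := Z) (W := Y), map_neg, neg_apply]
  rw [show (fun y ↦ g.val y (Z y) (Y y)) = fun y ↦ g.val y (Y y) (Z y) from
    funext fun y ↦ g.symm y _ _]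
  ring

/-- The vector field `X ∧_∇ Y`, for the Levi-Civita connection `∇` of `γ`:
`γ(Z, X ∧_∇ Y) = (1/2) (γ(X, ∇_Z Y) - γ(Y, ∇_Z X))`. -/
def wedge (X Y : VField E M) : VField E M := fun x ↦
  sharp g.val x ((1 / 2 : ℝ) •
    ((g.val x (X x)).comp (leviCivita g Y x) - (g.val x (Y x)).comp (leviCivita g X x)))

/-- The metric bracket `[X, Y]_γ = [X, Y] - X ∧_∇ Y`. -/
def metricBracket (X Y : VField E M) : VField E M := fun x ↦
  mlieBracket 𝓘(ℝ, E) X Y x - wedge g X Y x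

end LeviCivita

/-! ### Differential forms -/

lemma lieDeriv_tensorial {X : VField E M} {α : OneForm E M} {x : M} (hα : α.DiffAt x) :
    TensorialAt 𝓘(ℝ, E) E (fun Z : VField E M ↦
      mvfderiv 𝓘(ℝ, E) (fun y ↦ α y (Z y)) x (X x) - α x (mlieBracket 𝓘(ℝ, E) X Z x)) x where
  smul {f Z} hf hZ := by
    simp only [Pi.smul_apply', map_smul, smul_eq_mul,
      mvfderiv_fun_mul hf (hα.mdifferentiableAt hZ), mlieBracket_smul_right hf hZ, map_add,
      add_apply, smul_apply]
    ring
  add {Z Z'} hZ hZ' := by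
    simp only [Pi.add_apply, map_add,
      mvfderiv_fun_add (hα.mdifferentiableAt hZ) (hα.mdifferentiableAt hZ'),
      mlieBracket_add_right hZ hZ', add_apply]
    ring

open Classical in
/-- The Lie derivative `𝔏_X α` of a differentiable field `α` of linear forms:
`(𝔏_X α)(Z) = X(α(Z)) - α([X, Z])` (with the value `0` where `α` is not differentiable). -/
def lieDeriv (X : VField E M) (α : OneForm E M) : OneForm E M := fun x ↦
  if hα : α.DiffAt x then
    TensorialAt.mkHom (fun Z : VField E M ↦
      mvfderiv 𝓘(ℝ, E) (fun y ↦ α y (Z y)) x (X x) - α x (mlieBracket 𝓘(ℝ, E) X Z x)) x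
      (lieDeriv_tensorial hα)
  else 0

variable (E M) in
/-- Differential `2`-forms of class `C^∞`. -/
structure TwoForm where
  val : BilinField E M
  smooth : val.Smooth
  alternating : ∀ x u, val x u u = 0

/-- The right hand side of the invariant formula for `dω(X, Y, Z)`. -/
def extDerivAux (w : BilinField E M) (X Y Z : VField E M) (x : M) : ℝ :=
  mvfderiv 𝓘(ℝ, E) (fun y ↦ w y (Y y) (Z y)) x (X x)
    - mvfderiv 𝓘(ℝ, E) (fun y ↦ w y (X y) (Z y)) x (Y x)
    + mvfderiv 𝓘(ℝ, E) (fun y ↦ w y (X y) (Y y)) x (Z x)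
    - w x (mlieBracket 𝓘(ℝ, E) X Y x) (Z x)
    + w x (mlieBracket 𝓘(ℝ, E) X Z x) (Y x)
    - w x (mlieBracket 𝓘(ℝ, E) Y Z x) (X x)

section ExtDeriv

variable (w : TwoForm E M) {X Y Z : VField E M} {x : M}

lemma TwoForm.antisymm (x : M) (u v : TangentSpace 𝓘(ℝ, E) x) : w.val x u v = - w.val x v u := by
  have h := w.alternating x (u + v)
  simp only [map_add, add_apply, w.alternating] at h
  linarith

lemma extDerivAux_tensorial (hX : MDiffAt (T% X) x) (hY : MDiffAt (T% Y) x) :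
    TensorialAt 𝓘(ℝ, E) E (fun Z : VField E M ↦ extDerivAux w.val X Y Z x) x where
  smul {f Z} hf hZ := by
    have h1 := w.smooth.mdifferentiableAt hY hZ
    have h2 := w.smooth.mdifferentiableAt hX hZ
    simp only [extDerivAux, Pi.smul_apply', map_smul, smul_eq_mul, mvfderiv_fun_mul hf h1,
      mvfderiv_fun_mul hf h2, mlieBracket_smul_right hf hZ, map_add, add_apply, smul_apply,
      w.antisymm x (Z x)]
    ring
  add {Z Z'} hZ hZ' := by
    simp only [extDerivAux, Pi.add_apply, map_add,
      mvfderiv_fun_add (w.smooth.mdifferentiableAt hY hZ) (w.smooth.mdifferentiableAt hY hZ'),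
      mvfderiv_fun_add (w.smooth.mdifferentiableAt hX hZ) (w.smooth.mdifferentiableAt hX hZ'),
      mlieBracket_add_right hZ hZ', add_apply]
    ring

/-- `i(v) i(u) dω` at the point `x`, i.e. the linear form `dω(u, v, ·)`, computed by the invariant
formula on vector fields that extend the three vectors. -/
def extDeriv (x : M) (u v : TangentSpace 𝓘(ℝ, E) x) : TangentSpace 𝓘(ℝ, E) x →L[ℝ] ℝ :=
  TensorialAt.mkHom (fun Z : VField E M ↦ extDerivAux w.val (extend E u) (extend E v) Z x) x
    (extDerivAux_tensorial w (mdifferentiableAt_extend 𝓘(ℝ, E) E u)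
      (mdifferentiableAt_extend 𝓘(ℝ, E) E v))

lemma extDerivAux_swap₁₂ : extDerivAux w.val Y X Z x = - extDerivAux w.val X Y Z x := by
  simp only [extDerivAux, mlieBracket_swap_apply (V := Y) (W := X), map_neg, neg_apply]
  rw [show (fun y ↦ w.val y (Y y) (X y)) = fun y ↦ - w.val y (X y) (Y y) from
    funext fun y ↦ w.antisymm y _ _, mvfderiv_fun_neg]
  simp only [neg_apply]
  ring

lemma extDerivAux_swap₂₃ : extDerivAux w.val X Z Y x = - extDerivAux w.val X Y Z x := by
  simp only [extDerivAux, mlieBracket_swap_apply (V := Z) (W := Y), map_neg, neg_apply]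
  rw [show (fun y ↦ w.val y (Z y) (Y y)) = fun y ↦ - w.val y (Y y) (Z y) from
    funext fun y ↦ w.antisymm y _ _, mvfderiv_fun_neg]
  simp only [neg_apply]
  ring

/-- The value of `dω` on differentiable vector fields: the choice of extensions is immaterial. -/
lemma extDeriv_apply (hX : MDiffAt (T% X) x) (hY : MDiffAt (T% Y) x) (hZ : MDiffAt (T% Z) x) :
    extDeriv w x (X x) (Y x) (Z x) = extDerivAux w.val X Y Z x := by
  have hX' := mdifferentiableAt_extend 𝓘(ℝ, E) E (X x)
  have hY' := mdifferentiableAt_extend 𝓘(ℝ, E) E (Y x)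
  have h0 : extDeriv w x (X x) (Y x) (Z x)
      = extDerivAux w.val (extend E (X x)) (extend E (Y x)) Z x := TensorialAt.mkHom_apply _ hZ
  have h1 : extDerivAux w.val (extend E (X x)) Z (extend E (Y x)) x
      = extDerivAux w.val (extend E (X x)) Z Y x :=
    (extDerivAux_tensorial w hX' hZ).pointwise hY' hY (by simp)
  have h2 : extDerivAux w.val Y Z (extend E (X x)) x = extDerivAux w.val Y Z X x :=
    (extDerivAux_tensorial w hY hZ).pointwise hX' hX (by simp)
  rw [h0, extDerivAux_swap₂₃, h1, ← extDerivAux_swap₂₃, extDerivAux_swap₁₂, extDerivAux_swap₂₃, h2,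
    ← extDerivAux_swap₂₃, ← extDerivAux_swap₁₂]

end ExtDeriv

/-! ### Courant brackets -/

/-- The Courant bracket of sections `(Y, α)` of `TM ⊕ T*M`:
`[(Y₁, α₁), (Y₂, α₂)] = ([Y₁, Y₂], 𝔏_{Y₁} α₂ - 𝔏_{Y₂} α₁ + (1/2) d(α₁(Y₂) - α₂(Y₁)))`. -/
def courantBracket (a b : VField E M × OneForm E M) : VField E M × OneForm E M :=
  (mlieBracket 𝓘(ℝ, E) a.1 b.1,
    fun x ↦ lieDeriv a.1 b.2 x - lieDeriv b.1 a.2 x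
      + (1 / 2 : ℝ) • mvfderiv 𝓘(ℝ, E) (fun y ↦ a.2 y (b.1 y) - b.2 y (a.1 y)) x)

/-- The Courant bracket of the foliation tangent to `L`, transferred to `TM`. Here `TM = L ⊕ L'`,
`P` is the projection onto `L` along `L'`, and the non degenerate form `w` vanishes on `L` and on
`L'`. A vector field `X` corresponds to the section `(P X, ♭_w (X - P X))` of `L ⊕ T*M / ann L`. A
section `(Y, α)` of the latter corresponds to `Y + ♯_w (pr α)`, where `pr α = α ∘ P` is the
projection of `α` to `ann L'` along `ann L`; it depends only on the class of `α` modulo `ann L`. -/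
def foliationBracket (P : EndField E M) (w : BilinField E M) (X Y : VField E M) : VField E M :=
  fun x ↦
    let c := courantBracket
      (fun y ↦ P y (X y), flat w fun y ↦ X y - P y (X y))
      (fun y ↦ P y (Y y), flat w fun y ↦ Y y - P y (Y y))
    c.1 x + sharp w x ((c.2 x).comp (P x))

/-! ### Para-Hermitian manifolds -/

lemma contMDiffAt_precomp_comp {f : M → E →L[ℝ] E} {g : M → E →L[ℝ] E →L[ℝ] ℝ} {x : M}
    (hf : ContMDiffAt 𝓘(ℝ, E) 𝓘(ℝ, E →L[ℝ] E) ∞ f x)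
    (hg : ContMDiffAt 𝓘(ℝ, E) 𝓘(ℝ, E →L[ℝ] E →L[ℝ] ℝ) ∞ g x) :
    ContMDiffAt 𝓘(ℝ, E) 𝓘(ℝ, E →L[ℝ] E →L[ℝ] ℝ) ∞
      (fun y ↦ ((f y).precomp ℝ).comp (g y)) x :=
  (ContMDiffAt.clm_precomp (F₃ := ℝ) hf).clm_comp hg

/-- The field of subspaces given by the `c`-eigenspaces of `F` is involutive: the bracket of two
local vector fields with values in the eigenspaces has values in the eigenspaces. -/
def Involutive (F : EndField E M) (c : ℝ) : Prop :=
  ∀ (x : M) (X Y : VField E M), X.SmoothAt x → Y.SmoothAt x →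
    (∀ᶠ y in 𝓝 x, F y (X y) = c • X y) → (∀ᶠ y in 𝓝 x, F y (Y y) = c • Y y) →
    F x (mlieBracket 𝓘(ℝ, E) X Y x) = c • mlieBracket 𝓘(ℝ, E) X Y x

variable (E M) in
/-- A para-Hermitian structure `(γ, F)` on `M`. -/
structure Structure where
  γ : PseudoMetric E M
  F : EndField E M
  smooth_F : F.Smooth
  F_sq : ∀ x u, F x (F x u) = u
  rank_eq : ∀ x, Module.finrank ℝ (Module.End.eigenspace (F x).toLinearMap 1)
    = Module.finrank ℝ (Module.End.eigenspace (F x).toLinearMap (-1))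
  compatible : ∀ x u v, γ.val x (F x u) v = - γ.val x u (F x v)
  involutive_pos : Involutive F 1
  involutive_neg : Involutive F (-1)

namespace Structure

variable (S : Structure E M)

/-- The projection of `TM` onto `L`, the `+1`-eigenbundle of `F`. -/
def prL : EndField E M := fun x ↦ (1 / 2 : ℝ) • (ContinuousLinearMap.id ℝ _ + S.F x)

/-- The projection of `TM` onto `L̄`, the `-1`-eigenbundle of `F`. -/
def prLbar : EndField E M := fun x ↦ (1 / 2 : ℝ) • (ContinuousLinearMap.id ℝ _ - S.F x)

/-- The fundamental form `ω(X, Y) = γ(X, F Y)`. -/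
def omegaVal : BilinField E M := fun x ↦
  (ContinuousLinearMap.precomp ℝ (S.F x)).comp (S.γ.val x)

lemma omegaVal_apply (x : M) (u v : TangentSpace 𝓘(ℝ, E) x) :
    S.omegaVal x u v = S.γ.val x u (S.F x v) := rfl

lemma omegaVal_smooth : S.omegaVal.Smooth := by
  intro x₀
  have hγ := (contMDiffAt_hom_bundle _).1 (S.γ.smooth x₀)
  have hF := (contMDiffAt_hom_bundle _).1 (S.smooth_F x₀)
  refine (contMDiffAt_hom_bundle _).2 ⟨hγ.1, ?_⟩
  have key : ContMDiffAt 𝓘(ℝ, E) 𝓘(ℝ, E →L[ℝ] E →L[ℝ] ℝ) ∞ (fun x ↦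
      ((ContinuousLinearMap.inCoordinates E (TangentSpace 𝓘(ℝ, E)) E (TangentSpace 𝓘(ℝ, E))
          x₀ x x₀ x (S.F x)).precomp ℝ).comp
      (ContinuousLinearMap.inCoordinates E (TangentSpace 𝓘(ℝ, E)) (E →L[ℝ] ℝ)
          (fun x : M ↦ TangentSpace 𝓘(ℝ, E) x →L[ℝ] ℝ) x₀ x x₀ x (S.γ.val x))) x₀ := by
    exact contMDiffAt_precomp_comp hF.2 hγ.2
  refine key.congr_of_eventuallyEq ?_
  have hmem : ∀ᶠ x in 𝓝 x₀, x ∈ (trivializationAt E (TangentSpace 𝓘(ℝ, E) : M → Type _) x₀).baseSet :=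
    (trivializationAt E (TangentSpace 𝓘(ℝ, E) : M → Type _) x₀).open_baseSet.mem_nhds
      (FiberBundle.mem_baseSet_trivializationAt' x₀)
  filter_upwards [hmem] with x hx
  ext u v
  have h1 := inCoordinates_apply_eq₂ (F₃ := ℝ) (E₃ := Bundle.Trivial M ℝ) (ϕ := S.omegaVal x)
    (v := u) (w := v) hx hx (Set.mem_univ _)
  have h2 := inCoordinates_apply_eq₂ (F₃ := ℝ) (E₃ := Bundle.Trivial M ℝ) (ϕ := S.γ.val x)
    (v := u) (w := ContinuousLinearMap.inCoordinates E (TangentSpace 𝓘(ℝ, E)) E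
      (TangentSpace 𝓘(ℝ, E)) x₀ x x₀ x (S.F x) v) hx hx (Set.mem_univ _)
  refine h1.trans (Eq.trans ?_ h2.symm)
  rw [ContinuousLinearMap.inCoordinates_eq hx hx]
  simp only [omegaVal_apply, ContinuousLinearMap.comp_apply,
    ContinuousLinearEquiv.coe_coe, Trivialization.symm_continuousLinearEquivAt_eq,
    Trivialization.continuousLinearEquivAt_apply]
  rw [Trivialization.symm_apply_apply_mk _ hx]
  rw [Trivialization.symmL_apply _ hx]

/-- The fundamental form, as a differential `2`-form. -/
def omega : TwoForm E M where
  val := S.omegaVal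
  smooth := S.omegaVal_smooth
  alternating x u := by
    have h := S.compatible x u u
    rw [S.γ.symm] at h
    rw [omegaVal_apply]
    linarith

/-- `[X, Y]_ω`, the sum of the Courant brackets of the foliations tangent to `L` and `L̄`; for the
second one, the roles of `L` and `L̄` are exchanged and `ω` is replaced by `-ω`. -/
def omegaBracket (X Y : VField E M) : VField E M := fun x ↦
  foliationBracket S.prL S.omegaVal X Y x
    + foliationBracket S.prLbar (fun y ↦ - S.omegaVal y) X Y x

/-- `M` is para-Kähler: `dω = 0`. -/
def IsParaKahler : Prop := ∀ x u v z, extDeriv S.omega x u v z = 0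

end Structure

end Definitions
end ParaHermitian
end

/-!
Since `ω` is non degenerate, it is enough to compare the two sides after pairing them with an
arbitrary vector field `Z` under `ω`. Each side then becomes an expression in derivatives
`U(ω(V, W))` and terms `ω([U, V], W)`.

For the metric bracket, the Koszul formula gives (`metricBracket_inner`)
`2 γ([X, Y]_γ, Z) = X γ(Y, Z) - Y γ(X, Z) + γ([X, Y], Z) + γ([Z, X], Y) - γ([Z, Y], X)`;
the derivative of `γ(X, Y)` along `Z` has cancelled. Replacing `Z` by `F Z` turns the left hand side
into `2 ω([X, Y]_γ, Z)`, and `γ(U, V) = ω(U, F V)` removes `γ` from the right hand side.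
For the Courant brackets, the definition of the Lie derivative gives `foliationBracket_inner`, and
for `dω(F X, F Y, Z)` one has the invariant formula.

All of these expressions are additive in `X`, `Y`, `Z`, so they expand over the components along `L`
and `L̄` (`Structure.brackets_inner`). Two facts kill the remaining discrepancies: `L` and `L̄` are
isotropic for `ω`, so only mixed derivatives survive, and they are involutive, so `ω([U, V], W) = 0`
when `U`, `V`, `W` are all in `L` or all in `L̄`. What is left agrees term by term, up to the
antisymmetry of `ω` and of the Lie bracket. In particular the terms `(1/2) d(ω(X, Y))` of the Courant
brackets cancel the derivative of `ω(F X, F Y) = -ω(X, Y)` along `Z` in `(1/2) dω(F X, F Y, Z)`.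
-/

namespace ParaHermitian

variable {E : Type*} [NormedAddCommGroup E] [NormedSpace ℝ E] [FiniteDimensional ℝ E]
  {M : Type*} [TopologicalSpace M] [ChartedSpace E M] [IsManifold 𝓘(ℝ, E) ∞ M]

/-! ### Smoothness and the Lie bracket of vector fields -/

lemma VField.SmoothAt.mdiffAt {X : VField E M} {x : M} (hX : X.SmoothAt x) : MDiffAt (T% X) x :=
  ContMDiffAt.mdifferentiableAt hX (by simp)

lemma EndField.Smooth.smoothAt_apply {F : EndField E M} (hF : F.Smooth) {X : VField E M} {x : M}
    (hX : X.SmoothAt x) : VField.SmoothAt (fun y ↦ F y (X y)) x :=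
  ContMDiffAt.clm_bundle_apply (F₁ := E) (F₂ := E) (hF x) hX

lemma BilinField.Smooth.neg {B : BilinField E M} (hB : B.Smooth) :
    BilinField.Smooth (fun y ↦ - B y) :=
  ContMDiff.neg_section hB

lemma BilinField.Smooth.diffAt_flat {B : BilinField E M} (hB : B.Smooth) {X : VField E M} {x : M}
    (hX : MDiffAt (T% X) x) : OneForm.DiffAt (flat B X) x :=
  MDifferentiableAt.clm_bundle_apply (F₁ := E) (F₂ := E →L[ℝ] ℝ)
    ((hB x).mdifferentiableAt (by simp)) hX

lemma mlieBracket_neg_left {X Y : VField E M} {x : M} (hX : MDiffAt (T% X) x) :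
    mlieBracket 𝓘(ℝ, E) (-X) Y x = - mlieBracket 𝓘(ℝ, E) X Y x := by
  have := mlieBracket_const_smul_left (c := (-1 : ℝ)) (W := Y) hX
  simpa using this

lemma mlieBracket_neg_right {X Y : VField E M} {x : M} (hY : MDiffAt (T% Y) x) :
    mlieBracket 𝓘(ℝ, E) X (-Y) x = - mlieBracket 𝓘(ℝ, E) X Y x := by
  have := mlieBracket_const_smul_right (c := (-1 : ℝ)) (V := X) hY
  simpa using this

lemma lieDeriv_apply {X Z : VField E M} {α : OneForm E M} {x : M} (hα : α.DiffAt x)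
    (hZ : MDiffAt (T% Z) x) :
    lieDeriv X α x (Z x)
      = mvfderiv 𝓘(ℝ, E) (fun y ↦ α y (Z y)) x (X x) - α x (mlieBracket 𝓘(ℝ, E) X Z x) := by
  rw [lieDeriv, dif_pos hα]
  exact TensorialAt.mkHom_apply _ hZ

/-! ### The brackets paired with a vector field -/

/-- `2 γ([X, Y]_γ, Z)` by the Koszul formula; the derivatives of `γ(X, Y)` along `Z` cancel. -/
lemma metricBracket_inner (g : PseudoMetric E M) {X Y Z : VField E M} {x : M}
    (hX : MDiffAt (T% X) x) (hY : MDiffAt (T% Y) x) (hZ : MDiffAt (T% Z) x) :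
    2 * g.val x (metricBracket g X Y x) (Z x)
      = mvfderiv 𝓘(ℝ, E) (fun y ↦ g.val y (Y y) (Z y)) x (X x)
        - mvfderiv 𝓘(ℝ, E) (fun y ↦ g.val y (X y) (Z y)) x (Y x)
        + g.val x (mlieBracket 𝓘(ℝ, E) X Y x) (Z x)
        + g.val x (mlieBracket 𝓘(ℝ, E) Z X x) (Y x)
        - g.val x (mlieBracket 𝓘(ℝ, E) Z Y x) (X x) := by
  have h := congr($(apply_sharp (g.nondegenerate x) ((1 / 2 : ℝ) •
    ((g.val x (X x)).comp (leviCivita g Y x) - (g.val x (Y x)).comp (leviCivita g X x)))) (Z x))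
  have h1 := leviCivitaFun_apply g hZ hY hX
  have h2 := leviCivitaFun_apply g hZ hX hY
  rw [g.symm] at h1 h2
  simp only [smul_apply, sub_apply, ContinuousLinearMap.comp_apply, smul_eq_mul] at h
  simp only [metricBracket, map_sub, sub_apply, wedge]
  rw [h]
  simp only [leviCivita]
  rw [h1, h2]
  simp only [koszul, mlieBracket_swap_apply (V := Y) (W := X), map_neg, neg_apply]
  rw [show (fun y ↦ g.val y (Y y) (X y)) = fun y ↦ g.val y (X y) (Y y) from
      funext fun y ↦ g.symm y _ _,
    show (fun y ↦ g.val y (Z y) (X y)) = fun y ↦ g.val y (X y) (Z y) from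
      funext fun y ↦ g.symm y _ _,
    show (fun y ↦ g.val y (Z y) (Y y)) = fun y ↦ g.val y (Y y) (Z y) from
      funext fun y ↦ g.symm y _ _]
  ring

/-- The foliation bracket paired with `Z`: the `1`-form part of the Courant bracket only sees the
component `Zₗ = P Z`, on which its Lie derivatives are evaluated by `lieDeriv_apply`. Here `Xₗ`,
`Yₗ`, `Zₗ` are the components of `X`, `Y`, `Z` in the image of `P`, and `Xₜ`, `Yₜ` the complementary
components of `X`, `Y`. -/
lemma foliationBracket_inner {P : EndField E M} {B : BilinField E M} (hB : B.Smooth) {x : M}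
    (hnd : ∀ u, (∀ v, B x u v = 0) → u = 0) {X Y Z Xₗ Xₜ Yₗ Yₜ Zₗ : VField E M}
    (hX : ∀ y, P y (X y) = Xₗ y) (hX' : ∀ y, X y - Xₗ y = Xₜ y)
    (hY : ∀ y, P y (Y y) = Yₗ y) (hY' : ∀ y, Y y - Yₗ y = Yₜ y) (hZ : P x (Z x) = Zₗ x)
    (dX : MDiffAt (T% Xₜ) x) (dY : MDiffAt (T% Yₜ) x) (dZ : MDiffAt (T% Zₗ) x) :
    B x (foliationBracket P B X Y x) (Z x)
      = B x (mlieBracket 𝓘(ℝ, E) Xₗ Yₗ x) (Z x)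
        + mvfderiv 𝓘(ℝ, E) (fun y ↦ B y (Yₜ y) (Zₗ y)) x (Xₗ x)
        - B x (Yₜ x) (mlieBracket 𝓘(ℝ, E) Xₗ Zₗ x)
        - mvfderiv 𝓘(ℝ, E) (fun y ↦ B y (Xₜ y) (Zₗ y)) x (Yₗ x)
        + B x (Xₜ x) (mlieBracket 𝓘(ℝ, E) Yₗ Zₗ x)
        + (1 / 2) * mvfderiv 𝓘(ℝ, E) (fun y ↦ B y (Xₜ y) (Yₗ y) - B y (Yₜ y) (Xₗ y)) x (Zₗ x) := by
  have h1 := lieDeriv_apply (X := Xₗ) (hB.diffAt_flat dY) dZ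
  have h2 := lieDeriv_apply (X := Yₗ) (hB.diffAt_flat dX) dZ
  simp only [foliationBracket, courantBracket, hX, hY, hX', hY', map_add, add_apply,
    apply_sharp hnd, ContinuousLinearMap.comp_apply, hZ, sub_apply, smul_apply, smul_eq_mul]
  erw [h1, h2]
  simp only [flat]
  ring

namespace Structure

variable (S : Structure E M)

/-! ### Algebra of the fundamental form -/

lemma γ_eq_omegaVal (x : M) (u v : TangentSpace 𝓘(ℝ, E) x) :
    S.γ.val x u v = S.omegaVal x u (S.F x v) := by
  rw [omegaVal_apply, S.F_sq]

lemma omegaVal_antisymm (x : M) (u v : TangentSpace 𝓘(ℝ, E) x) :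
    S.omegaVal x u v = - S.omegaVal x v u :=
  S.omega.antisymm x u v

lemma omegaVal_nondegenerate (x : M) (u : TangentSpace 𝓘(ℝ, E) x)
    (h : ∀ v, S.omegaVal x u v = 0) : u = 0 :=
  S.γ.nondegenerate x u fun v ↦ by rw [γ_eq_omegaVal, h]

/-- `L` and `L̄` are isotropic for `ω`. -/
lemma omegaVal_eq_zero {x : M} {c : ℝ} (hc : c ≠ 0) {u v : TangentSpace 𝓘(ℝ, E) x}
    (hu : S.F x u = c • u) (hv : S.F x v = c • v) : S.omegaVal x u v = 0 := by
  have h := S.compatible x u v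
  simp only [hu, hv, map_smul, smul_apply, smul_eq_mul] at h
  have h0 : S.γ.val x u v = 0 := by
    have : c * (2 * S.γ.val x u v) = 0 := by linarith
    simpa [hc] using this
  rw [omegaVal_apply, hv, map_smul, h0, smul_zero]

lemma F_prL (x : M) (u : TangentSpace 𝓘(ℝ, E) x) : S.F x (S.prL x u) = S.prL x u := by
  simp only [prL, smul_apply, add_apply, ContinuousLinearMap.id_apply, map_smul, map_add, S.F_sq,
    add_comm]

lemma F_prLbar (x : M) (u : TangentSpace 𝓘(ℝ, E) x) : S.F x (S.prLbar x u) = - S.prLbar x u := by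
  simp only [prLbar, smul_apply, sub_apply, ContinuousLinearMap.id_apply, map_smul, map_sub, S.F_sq,
    ← smul_neg, neg_sub]

lemma prL_add_prLbar (x : M) (u : TangentSpace 𝓘(ℝ, E) x) : S.prL x u + S.prLbar x u = u := by
  simp only [prL, prLbar, smul_apply, sub_apply, add_apply, ContinuousLinearMap.id_apply]
  module

lemma prL_smoothAt {X : VField E M} {x : M} (hX : X.SmoothAt x) :
    VField.SmoothAt (fun y ↦ S.prL y (X y)) x := by
  have := ContMDiffAt.const_smul_section (a := (1 / 2 : ℝ))
    (ContMDiffAt.add_section hX (S.smooth_F.smoothAt_apply hX))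
  exact this

lemma prLbar_smoothAt {X : VField E M} {x : M} (hX : X.SmoothAt x) :
    VField.SmoothAt (fun y ↦ S.prLbar y (X y)) x := by
  have := ContMDiffAt.const_smul_section (a := (1 / 2 : ℝ))
    (ContMDiffAt.sub_section hX (S.smooth_F.smoothAt_apply hX))
  exact this

lemma omegaVal_mlieBracket_pos {X Y Z : VField E M} {x : M} (hX : X.SmoothAt x)
    (hY : Y.SmoothAt x) (fX : ∀ y, S.F y (X y) = X y) (fY : ∀ y, S.F y (Y y) = Y y)
    (fZ : ∀ y, S.F y (Z y) = Z y) :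
    S.omegaVal x (mlieBracket 𝓘(ℝ, E) X Y x) (Z x) = 0 :=
  S.omegaVal_eq_zero one_ne_zero
    (S.involutive_pos x X Y hX hY (.of_forall fun y ↦ by simp [fX])
      (.of_forall fun y ↦ by simp [fY])) (by simp [fZ])

lemma omegaVal_mlieBracket_neg {X Y Z : VField E M} {x : M} (hX : X.SmoothAt x)
    (hY : Y.SmoothAt x) (fX : ∀ y, S.F y (X y) = - X y) (fY : ∀ y, S.F y (Y y) = - Y y)
    (fZ : ∀ y, S.F y (Z y) = - Z y) :
    S.omegaVal x (mlieBracket 𝓘(ℝ, E) X Y x) (Z x) = 0 :=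
  S.omegaVal_eq_zero (c := -1) (by norm_num)
    (S.involutive_neg x X Y hX hY (.of_forall fun y ↦ by simp [fX])
      (.of_forall fun y ↦ by simp [fY])) (by simp [fZ])

/-! ### Comparison of the brackets -/

/-- The comparison of `[X, Y]_γ` with `[X, Y]_ω`, paired with `Z` under `ω` and multiplied by `2`,
for vector fields given by their components along `L` (index `ₗ`) and `L̄` (index `ₜ`). The fields
`Xₗ + -Xₜ` and `Yₗ + -Yₜ` are `F X` and `F Y`. -/
lemma brackets_inner {Xₗ Xₜ Yₗ Yₜ Zₗ Zₜ : VField E M} {x : M}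
    (sXₗ : Xₗ.SmoothAt x) (sXₜ : Xₜ.SmoothAt x) (sYₗ : Yₗ.SmoothAt x) (sYₜ : Yₜ.SmoothAt x)
    (sZₗ : Zₗ.SmoothAt x) (sZₜ : Zₜ.SmoothAt x)
    (fXₗ : ∀ y, S.F y (Xₗ y) = Xₗ y) (fXₜ : ∀ y, S.F y (Xₜ y) = - Xₜ y)
    (fYₗ : ∀ y, S.F y (Yₗ y) = Yₗ y) (fYₜ : ∀ y, S.F y (Yₜ y) = - Yₜ y)
    (fZₗ : ∀ y, S.F y (Zₗ y) = Zₗ y) (fZₜ : ∀ y, S.F y (Zₜ y) = - Zₜ y) :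
    2 * S.omegaVal x (metricBracket S.γ (Xₗ + Xₜ) (Yₗ + Yₜ) x) ((Zₗ + Zₜ) x)
      = 2 * S.omegaVal x (S.omegaBracket (Xₗ + Xₜ) (Yₗ + Yₜ) x) ((Zₗ + Zₜ) x)
        + extDerivAux S.omegaVal (Xₗ + -Xₜ) (Yₗ + -Yₜ) (Zₗ + Zₜ) x := by
  have dXₗ := sXₗ.mdiffAt
  have dXₜ := sXₜ.mdiffAt
  have dYₗ := sYₗ.mdiffAt
  have dYₜ := sYₜ.mdiffAt
  have dZₗ := sZₗ.mdiffAt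
  have dZₜ := sZₜ.mdiffAt
  have nXₜ : MDiffAt (T% (-Xₜ)) x := mdifferentiableAt_neg_section dXₜ
  have nYₜ : MDiffAt (T% (-Yₜ)) x := mdifferentiableAt_neg_section dYₜ
  have nZₜ : MDiffAt (T% (-Zₜ)) x := mdifferentiableAt_neg_section dZₜ
  have hω := S.omegaVal_smooth
  have isoₗ : ∀ {U V : VField E M}, (∀ y, S.F y (U y) = U y) → (∀ y, S.F y (V y) = V y) →
      ∀ y, S.omegaVal y (U y) (V y) = 0 := fun fU fV y ↦
    S.omegaVal_eq_zero one_ne_zero (by simp [fU]) (by simp [fV])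
  have isoₜ : ∀ {U V : VField E M}, (∀ y, S.F y (U y) = - U y) → (∀ y, S.F y (V y) = - V y) →
      ∀ y, S.omegaVal y (U y) (V y) = 0 := fun fU fV y ↦
    S.omegaVal_eq_zero (c := -1) (by norm_num) (by simp [fU]) (by simp [fV])
  -- Derivatives of `ω(U, V)`: only the mixed components contribute.
  have hD : ∀ {U U' V V' : VField E M} (v : TangentSpace 𝓘(ℝ, E) x),
      (∀ y, S.F y (U y) = U y) → (∀ y, S.F y (U' y) = - U' y) →
      (∀ y, S.F y (V y) = V y) → (∀ y, S.F y (V' y) = - V' y) →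
      MDiffAt (T% U) x → MDiffAt (T% U') x → MDiffAt (T% V) x → MDiffAt (T% V') x →
      mvfderiv 𝓘(ℝ, E) (fun y ↦ S.omegaVal y ((U + U') y) ((V + V') y)) x v
        = mvfderiv 𝓘(ℝ, E) (fun y ↦ S.omegaVal y (U y) (V' y)) x v
          + mvfderiv 𝓘(ℝ, E) (fun y ↦ S.omegaVal y (U' y) (V y)) x v := by
    intro U U' V V' v fU fU' fV fV' dU dU' dV dV'
    rw [← add_apply, ← mvfderiv_fun_add (hω.mdifferentiableAt dU dV')
      (hω.mdifferentiableAt dU' dV)]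
    congr 2
    funext y
    simp only [Pi.add_apply, map_add, add_apply, isoₗ fU fV, isoₜ fU' fV', zero_add,
      add_comm]
  have fnXₜ : ∀ y, S.F y ((-Xₜ) y) = - (-Xₜ) y := fun y ↦ by simp [fXₜ]
  have fnYₜ : ∀ y, S.F y ((-Yₜ) y) = - (-Yₜ) y := fun y ↦ by simp [fYₜ]
  -- The metric side, expressed through `ω` by evaluating `γ` on `F Z`.
  have hFX : ∀ y, S.F y ((Xₗ + Xₜ) y) = (Xₗ + -Xₜ) y := fun y ↦ by simp [fXₗ, fXₜ]
  have hFY : ∀ y, S.F y ((Yₗ + Yₜ) y) = (Yₗ + -Yₜ) y := fun y ↦ by simp [fYₗ, fYₜ]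
  have hFZ : ∀ y, S.F y ((Zₗ + -Zₜ) y) = (Zₗ + Zₜ) y := fun y ↦ by simp [fZₗ, fZₜ]
  have hmet := metricBracket_inner S.γ (mdifferentiableAt_add_section dXₗ dXₜ)
    (mdifferentiableAt_add_section dYₗ dYₜ) (mdifferentiableAt_add_section dZₗ nZₜ)
  simp only [γ_eq_omegaVal, hFX, hFY, hFZ] at hmet
  rw [hD _ fYₗ fYₜ fZₗ fZₜ dYₗ dYₜ dZₗ dZₜ, hD _ fXₗ fXₜ fZₗ fZₜ dXₗ dXₜ dZₗ dZₜ] at hmet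
  -- The two Courant brackets.
  have pₗ : ∀ {U V : VField E M}, (∀ y, S.F y (U y) = U y) → (∀ y, S.F y (V y) = - V y) →
      ∀ y, S.prL y ((U + V) y) = U y := by
    intro U V fU fV y
    simp only [prL, Pi.add_apply, smul_apply, add_apply, ContinuousLinearMap.id_apply, map_add,
      fU, fV]
    module
  have pₜ : ∀ {U V : VField E M}, (∀ y, S.F y (U y) = U y) → (∀ y, S.F y (V y) = - V y) →
      ∀ y, S.prLbar y ((U + V) y) = V y := by
    intro U V fU fV y
    simp only [prLbar, Pi.add_apply, smul_apply, sub_apply, ContinuousLinearMap.id_apply, map_add,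
      fU, fV]
    module
  have hL := foliationBracket_inner (Z := Zₗ + Zₜ) hω (S.omegaVal_nondegenerate x) (pₗ fXₗ fXₜ)
    (Xₜ := Xₜ) (fun y ↦ by simp) (pₗ fYₗ fYₜ) (Yₜ := Yₜ) (fun y ↦ by simp) (pₗ fZₗ fZₜ x) dXₜ dYₜ dZₗ
  have hLbar := foliationBracket_inner (Z := Zₗ + Zₜ) hω.neg
    (fun u hu ↦ S.omegaVal_nondegenerate x u fun v ↦ by simpa using hu v) (pₜ fXₗ fXₜ)
    (Xₜ := Xₗ) (fun y ↦ by simp) (pₜ fYₗ fYₜ) (Yₜ := Yₗ) (fun y ↦ by simp) (pₜ fZₗ fZₜ x) dXₗ dYₗ dZₜ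
  simp only [neg_apply] at hLbar
  -- The function under `(1/2) d` in each Courant bracket is `ω(X, Y)` up to sign, split into the
  -- same two mixed components as in `hD`.
  have hsub : ∀ {U U' V V' : VField E M} (v : TangentSpace 𝓘(ℝ, E) x),
      MDiffAt (T% U) x → MDiffAt (T% U') x → MDiffAt (T% V) x → MDiffAt (T% V') x →
      mvfderiv 𝓘(ℝ, E) (fun y ↦ S.omegaVal y (U y) (V y) - S.omegaVal y (V' y) (U' y)) x v
        = mvfderiv 𝓘(ℝ, E) (fun y ↦ S.omegaVal y (U y) (V y)) x v
          + mvfderiv 𝓘(ℝ, E) (fun y ↦ S.omegaVal y (U' y) (V' y)) x v := by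
    intro U U' V V' v dU dU' dV dV'
    rw [← add_apply, ← mvfderiv_fun_add (hω.mdifferentiableAt dU dV)
      (hω.mdifferentiableAt dU' dV')]
    congr 2
    funext y
    rw [S.omegaVal_antisymm y (V' y), sub_neg_eq_add]
  rw [hsub _ dXₜ dXₗ dYₗ dYₜ] at hL
  have hneg : (fun y ↦ - S.omegaVal y (Xₗ y) (Yₜ y) - - S.omegaVal y (Yₗ y) (Xₜ y))
      = fun y ↦ - (S.omegaVal y (Xₗ y) (Yₜ y) - S.omegaVal y (Yₗ y) (Xₜ y)) := by
    funext y; ring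
  rw [hneg] at hLbar
  simp only [mvfderiv_fun_neg, neg_apply, hsub _ dXₗ dXₜ dYₜ dYₗ] at hLbar
  rw [omegaBracket, map_add, add_apply, hmet, hL, neg_eq_iff_eq_neg.1 hLbar, extDerivAux,
    hD _ fYₗ fnYₜ fZₗ fZₜ dYₗ nYₜ dZₗ dZₜ, hD _ fXₗ fnXₜ fZₗ fZₜ dXₗ nXₜ dZₗ dZₜ,
    hD _ fXₗ fnXₜ fYₗ fnYₜ dXₗ nXₜ dYₗ nYₜ]
  -- Expansion over the components; brackets are ordered `[X, Y]`, `[X, Z]`, `[Y, Z]` and put in the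
  -- first slot of `ω`, and those with three components of the same type vanish by involutivity.
  simp only [mlieBracket_add_left dXₗ dXₜ, mlieBracket_add_left dXₗ nXₜ,
    mlieBracket_add_left dYₗ nYₜ, mlieBracket_add_left dZₗ nZₜ,
    mlieBracket_add_right dXₗ dXₜ, mlieBracket_add_right dYₗ dYₜ, mlieBracket_add_right dYₗ nYₜ,
    mlieBracket_add_right dZₗ dZₜ, mlieBracket_neg_left dXₜ, mlieBracket_neg_left dYₜ,
    mlieBracket_neg_left dZₜ, mlieBracket_neg_right dYₜ, Pi.add_apply, Pi.neg_apply, map_add,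
    map_neg, add_apply, neg_apply, mvfderiv_fun_neg,
    mlieBracket_swap_apply (V := Zₗ) (W := Xₗ), mlieBracket_swap_apply (V := Zₗ) (W := Xₜ),
    mlieBracket_swap_apply (V := Zₜ) (W := Xₗ), mlieBracket_swap_apply (V := Zₜ) (W := Xₜ),
    mlieBracket_swap_apply (V := Zₗ) (W := Yₗ), mlieBracket_swap_apply (V := Zₗ) (W := Yₜ),
    mlieBracket_swap_apply (V := Zₜ) (W := Yₗ), mlieBracket_swap_apply (V := Zₜ) (W := Yₜ),
    S.omegaVal_antisymm x (Xₗ x), S.omegaVal_antisymm x (Xₜ x),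
    S.omegaVal_antisymm x (Yₗ x), S.omegaVal_antisymm x (Yₜ x),
    S.omegaVal_mlieBracket_pos sXₗ sYₗ fXₗ fYₗ fZₗ, S.omegaVal_mlieBracket_pos sXₗ sZₗ fXₗ fZₗ fYₗ,
    S.omegaVal_mlieBracket_pos sYₗ sZₗ fYₗ fZₗ fXₗ, S.omegaVal_mlieBracket_neg sXₜ sYₜ fXₜ fYₜ fZₜ,
    S.omegaVal_mlieBracket_neg sXₜ sZₜ fXₜ fZₜ fYₜ, S.omegaVal_mlieBracket_neg sYₜ sZₜ fYₜ fZₜ fXₜ]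
  ring

/-- The comparison of the brackets at `x` only needs smoothness near `x`. -/
lemma metricBracket_eq_omegaBracket_add {X Y : VField E M} {x : M} (hX : X.SmoothAt x)
    (hY : Y.SmoothAt x) :
    metricBracket S.γ X Y x = S.omegaBracket X Y x
      + (1 / 2 : ℝ) • sharp S.omegaVal x (extDeriv S.omega x (S.F x (X x)) (S.F x (Y x))) := by
  -- Both sides are compared by pairing them under `ω` with an arbitrary vector `z`, which is
  -- extended to a field `Z` smooth near `x`.
  refine sub_eq_zero.1 (S.omegaVal_nondegenerate x _ fun z ↦ ?_)
  obtain ⟨Z, hZ, rfl⟩ : ∃ Z : VField E M, Z.SmoothAt x ∧ Z x = z :=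
    ⟨extend E z, contMDiffAt_extend 𝓘(ℝ, E) E z, by simp⟩
  have dec : ∀ U : VField E M, (fun y ↦ S.prL y (U y)) + (fun y ↦ S.prLbar y (U y)) = U :=
    fun U ↦ funext fun y ↦ S.prL_add_prLbar y (U y)
  have decF : ∀ U : VField E M,
      (fun y ↦ S.prL y (U y)) + -(fun y ↦ S.prLbar y (U y)) = fun y ↦ S.F y (U y) := by
    intro U
    funext y
    conv_rhs => rw [← S.prL_add_prLbar y (U y), map_add, S.F_prL, S.F_prLbar]
    rfl
  have h := S.brackets_inner (S.prL_smoothAt hX) (S.prLbar_smoothAt hX) (S.prL_smoothAt hY)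
    (S.prLbar_smoothAt hY) (S.prL_smoothAt hZ) (S.prLbar_smoothAt hZ)
    (fun y ↦ S.F_prL y _) (fun y ↦ S.F_prLbar y _) (fun y ↦ S.F_prL y _)
    (fun y ↦ S.F_prLbar y _) (fun y ↦ S.F_prL y _) (fun y ↦ S.F_prLbar y _)
  rw [dec, dec, dec, decF, decF] at h
  have hd := extDeriv_apply S.omega (S.smooth_F.smoothAt_apply hX).mdiffAt
    (S.smooth_F.smoothAt_apply hY).mdiffAt hZ.mdiffAt
  have hs := congr($(apply_sharp (S.omegaVal_nondegenerate x)
    (extDeriv S.omega x (S.F x (X x)) (S.F x (Y x)))) (Z x))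
  simp only [map_sub, map_add, map_smul, sub_apply, add_apply, smul_apply, smul_eq_mul]
  rw [hs, hd]
  change _ = _ + extDerivAux S.omega.val _ _ _ x at h
  linarith

end Structure
end ParaHermitian

theorem proposition3p2
    {E : Type*} [NormedAddCommGroup E] [NormedSpace ℝ E] [FiniteDimensional ℝ E]
    {M : Type*} [TopologicalSpace M] [ChartedSpace E M] [IsManifold 𝓘(ℝ, E) ∞ M]
    (S : ParaHermitian.Structure E M) :
    (∀ X Y : ParaHermitian.VField E M, X.Smooth → Y.Smooth → ∀ x : M,
      ParaHermitian.metricBracket S.γ X Y x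
        = S.omegaBracket X Y x
          + (1 / 2 : ℝ) • ParaHermitian.sharp S.omegaVal x
              (ParaHermitian.extDeriv S.omega x (S.F x (X x)) (S.F x (Y x)))) ∧
    (S.IsParaKahler → ∀ X Y : ParaHermitian.VField E M, X.Smooth → Y.Smooth → ∀ x : M,
      ParaHermitian.metricBracket S.γ X Y x = S.omegaBracket X Y x) := by
  refine ⟨fun X Y hX hY x ↦ S.metricBracket_eq_omegaBracket_add (hX x) (hY x),
    fun hS X Y hX hY x ↦ ?_⟩
  have h0 : ParaHermitian.extDeriv S.omega x (S.F x (X x)) (S.F x (Y x)) = 0 :=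
    ContinuousLinearMap.ext fun z ↦ hS x _ _ z
  have hs : ParaHermitian.sharp S.omegaVal x 0 = 0 := by
    refine S.omegaVal_nondegenerate x _ fun v ↦ ?_
    rw [ParaHermitian.apply_sharp (S.omegaVal_nondegenerate x), zero_apply]
  rw [S.metricBracket_eq_omegaBracket_add (hX x) (hY x), h0, hs, smul_zero, add_zero]
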